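/- Let $d\ge 2$ and $k\ge 0$ be integers. Then there is an integer $N=N(d,k)$, depending only on $d$ and $k$, such that the following holds for every finite simple $2d$-regular graph $G$ (with any number of connected components): if exactly $k$ of the components of $G$ have an odd number of vertices, and each of these $k$ components has at least $N$ vertices, then $G$ has an antimagic orientation. That is, one can replace each edge of $G$ by exactly one of its two possible arcs, and label the $m$ resulting arcs bijectively by $1,2,\ldots,m$, so that no two distinct vertices have the same vertex-sum, where the vertex-sum of a vertex $u$ is the sum of the labels of the arcs entering $u$ minus the sum of the labels of the arcs leaving $u$. -/

import Mathlib

/-- The digraph `D` is an orientation of the simple graph `G`: it has the same vertices, and it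
arises from `G` by replacing every edge by exactly one of its two possible arcs. -/
def Digraph.IsOrientationOf {V : Type*} (D : Digraph V) (G : SimpleGraph V) : Prop :=
  (∀ u v : V, G.Adj u v ↔ D.Adj u v ∨ D.Adj v u) ∧ ∀ u v : V, D.Adj u v → ¬ D.Adj v u

/-- The set of arcs of a digraph; the arc `a` leaves `a.1.1` and enters `a.1.2`. -/
abbrev Digraph.Arc {V : Type*} (D : Digraph V) : Type _ :=
  {a : V × V // D.Adj a.1 a.2}

/-- A labeling of a digraph with `m` arcs: a bijection from its arcs to `{1, 2, …, m}`. -/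
abbrev Digraph.Labeling {V : Type*} (D : Digraph V) : Type _ :=
  D.Arc ≃ Finset.Icc 1 (Nat.card D.Arc)

open Classical in
/-- The vertex-sum of `u`: the sum of the labels of all arcs entering `u` minus the sum of the
labels of all arcs leaving `u`. -/
noncomputable def Digraph.vertexSum {V : Type*} [Fintype V] (D : Digraph V) (c : D.Labeling)
    (u : V) : ℤ :=
  (∑ a : D.Arc with a.1.2 = u, ((c a : ℕ) : ℤ)) - ∑ a : D.Arc with a.1.1 = u, ((c a : ℕ) : ℤ)

/-- A labeling is antimagic if no two vertices have the same vertex-sum. -/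
def Digraph.IsAntimagicLabeling {V : Type*} [Fintype V] (D : Digraph V) (c : D.Labeling) : Prop :=
  Function.Injective (D.vertexSum c)

/-- `G` has an antimagic orientation: some orientation of `G` has an antimagic labeling. -/
def SimpleGraph.HasAntimagicOrientation {V : Type*} [Fintype V] (G : SimpleGraph V) : Prop :=
  ∃ D : Digraph V, D.IsOrientationOf G ∧ ∃ c : D.Labeling, D.IsAntimagicLabeling c

/-!
The edges of `G` are cut into directed trails, called segments, and the labels along each segment
are consecutive and increase in its direction. A vertex passed by a segment then gets `-1` from
that passage, so up to a common constant the vertex-sum depends only on the segments that start or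
end at the vertex: if segment `i` carries the labels `a i + 1, …, a i + l i`, then
`2 * vertexSum v + 2 * d` is the sum of `2 * (a i + l i) + 1` over the segments ending at `v` minus
the sum of `2 * a i + 1` over those starting at `v`
(`SimpleGraph.hasAntimagicOrientation_of_trails`).

A component with `n` vertices has an Euler tour. Cutting it at one visit of each vertex gives `n`
segments in cyclic order, which are directed alternately forwards and backwards
(`SimpleGraph.ConnectedComponent.SplitTour`). Vertex `k` of the cyclic order is then a sink (two
segments end there) for odd `k` and a source (two segments start there) for even `k`; only if `n`
is odd is vertex `0` exceptional: the last segment ends there and the first one starts there. Up to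
the common constant sinks have positive and sources negative sums. It remains to order the
label intervals.

Components get consecutive blocks of labels, so sinks (or sources) of different components never
collide. Inside a component the intervals are laid out in the order of a key, chosen so that of the
pairs of segments at two sinks (or sources) one always dominates the other; this makes the sums
distinct (`isArrangement_keyOffset`). Two keys are used.

* The tent key goes up the cyclic order from both sides of vertex `0` alternately, after a head
  start of `r` segments. The exceptional sum, `a (n - 1) + l (n - 1) - a 0`, is then the total
  length of the segments `n - 1, 0, …, r`, so it takes a different value for each `r`. By averaging,
  the tour can be rotated so that these values stay below a bound depending only on `d` and `k`
  for all `r < k`, and a distinct representatives argument makes them differ between the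
  odd components.
* The tier key puts the segments of even index below those of odd index. It is used for a single odd
  component, which gets the smallest labels. Its exceptional sum is the total length of the segments
  of even index, at least half its number of vertices and hence larger than the bound, yet every
  sink of `G` exceeds it.

So the exceptional sums are distinct, nonnegative, and smaller than the sum of every sink.
-/

/-! ### Trails with increasing labels -/

/-- Summation by parts along one trail with labels `a + 1, …, a + l`. For `f` the indicator of
a vertex along the trail, the sum subtracted on the right counts its incidences with the trail. -/
theorem two_mul_sum_range_mul_sub (a : ℤ) (f : ℕ → ℤ) (l : ℕ) :
    2 * ∑ p ∈ Finset.range l, (a + p + 1) * (f (p + 1) - f p) =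
      (2 * (a + l) + 1) * f l - (2 * a + 1) * f 0 -
        ∑ p ∈ Finset.range l, (f p + f (p + 1)) := by
  induction l with
  | zero => simp
  | succ l ih =>
    rw [Finset.sum_range_succ, Finset.sum_range_succ, mul_add, ih]
    push_cast
    ring

open Classical in
theorem SimpleGraph.sum_incidences_eq_degree {V : Type*} [Fintype V] (G : SimpleGraph V)
    [DecidableRel G.Adj] {J : Type*} [Fintype J] (tail head : J → V)
    (hadj : ∀ j, G.Adj (tail j) (head j))
    (hinj : ∀ i j, s(tail i, head i) = s(tail j, head j) → i = j)
    (hsurj : ∀ u v, G.Adj u v → ∃ j, s(tail j, head j) = s(u, v)) (v : V) :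
    ∑ j, ((if tail j = v then (1 : ℤ) else 0) + if head j = v then 1 else 0) = G.degree v := by
  have h1 : G.neighborFinset v =
      (Finset.univ.filter fun j => tail j = v).image head ∪
        (Finset.univ.filter fun j => head j = v).image tail := by
    ext u
    simp only [SimpleGraph.mem_neighborFinset, Finset.mem_union, Finset.mem_image,
      Finset.mem_filter, Finset.mem_univ, true_and]
    constructor
    · intro h
      obtain ⟨j, hj⟩ := hsurj _ _ h
      rcases Sym2.eq_iff.1 hj with h | h
      · exact Or.inl ⟨j, h⟩
      · exact Or.inr ⟨j, h.2, h.1⟩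
    · rintro (⟨j, rfl, rfl⟩ | ⟨j, rfl, rfl⟩)
      · exact hadj j
      · exact (hadj j).symm
  have h2 : Disjoint ((Finset.univ.filter fun j => tail j = v).image head)
      ((Finset.univ.filter fun j => head j = v).image tail) := by
    rw [Finset.disjoint_left]
    simp only [Finset.mem_image, Finset.mem_filter, Finset.mem_univ, true_and]
    rintro u ⟨i, hi, hi'⟩ ⟨j, hj, hj'⟩
    have : i = j := hinj i j (by rw [hi, hi', hj, hj', Sym2.eq_swap])
    subst this
    exact (hadj i).ne (hi.trans hj.symm)
  have h3 : ∀ i ∈ (Finset.univ.filter fun j => tail j = v),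
      ∀ j ∈ (Finset.univ.filter fun j => tail j = v), head i = head j → i = j := by
    simp only [Finset.mem_filter, Finset.mem_univ, true_and]
    intro i hi j hj h
    exact hinj i j (by rw [hi, hj, h])
  have h4 : ∀ i ∈ (Finset.univ.filter fun j => head j = v),
      ∀ j ∈ (Finset.univ.filter fun j => head j = v), tail i = tail j → i = j := by
    simp only [Finset.mem_filter, Finset.mem_univ, true_and]
    intro i hi j hj h
    exact hinj i j (by rw [hi, hj, h])
  rw [← G.card_neighborFinset_eq_degree, h1, Finset.card_union_of_disjoint h2,
    Finset.card_image_of_injOn h3, Finset.card_image_of_injOn h4, Finset.sum_add_distrib]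
  simp

open Classical in
/-- The labelling that increases along each of a family of directed trails partitioning the edges:
trail `i` visits `x i 0, …, x i (l i)` and carries the labels `a i + 1, …, a i + l i`. By regularity
it is antimagic as soon as the signed sums over the ends of the trails are distinct. -/
theorem SimpleGraph.hasAntimagicOrientation_of_trails {V : Type*} [Fintype V] (G : SimpleGraph V)
    [DecidableRel G.Adj] {k : ℕ} (hreg : G.IsRegularOfDegree k)
    {ι : Type*} [Fintype ι] (l a : ι → ℕ) (x : ι → ℕ → V)
    (hadj : ∀ i, ∀ p < l i, G.Adj (x i p) (x i (p + 1)))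
    (hinj : ∀ i, ∀ p < l i, ∀ j, ∀ q < l j,
      s(x i p, x i (p + 1)) = s(x j q, x j (q + 1)) → i = j ∧ p = q)
    (hsurj : ∀ u v, G.Adj u v → ∃ i, ∃ p < l i, s(x i p, x i (p + 1)) = s(u, v))
    (hlabel : ∀ i, ∀ p < l i, ∀ j, ∀ q < l j, a i + p = a j + q → i = j ∧ p = q)
    (hbound : ∀ i, a i + l i ≤ ∑ j, l j)
    (hsum : Function.Injective fun v : V =>
      (∑ i, if x i (l i) = v then 2 * ((a i : ℤ) + l i) + 1 else 0) -
        ∑ i, if x i 0 = v then 2 * (a i : ℤ) + 1 else 0) :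
    G.HasAntimagicOrientation := by
  let J := Σ i, Fin (l i)
  let tail : J → V := fun j => x j.1 j.2
  let head : J → V := fun j => x j.1 (j.2 + 1)
  have hJadj : ∀ j : J, G.Adj (tail j) (head j) := fun j => hadj _ _ j.2.2
  have hJinj : ∀ i j : J, s(tail i, head i) = s(tail j, head j) → i = j := by
    rintro ⟨i, p, hp⟩ ⟨j, q, hq⟩ h
    obtain ⟨rfl, rfl⟩ := hinj i p hp j q hq h
    rfl
  have hJsurj : ∀ u v, G.Adj u v → ∃ j : J, s(tail j, head j) = s(u, v) := by
    intro u v h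
    obtain ⟨i, p, hp, h⟩ := hsurj u v h
    exact ⟨⟨i, p, hp⟩, h⟩
  let D : Digraph V := ⟨fun u v => ∃ j : J, tail j = u ∧ head j = v⟩
  have hD : D.IsOrientationOf G := by
    refine ⟨fun u v => ⟨fun h => ?_, ?_⟩, ?_⟩
    · obtain ⟨j, hj⟩ := hJsurj u v h
      rcases Sym2.eq_iff.1 hj with h | h
      · exact Or.inl ⟨j, h⟩
      · exact Or.inr ⟨j, h⟩
    · rintro (⟨j, rfl, rfl⟩ | ⟨j, rfl, rfl⟩)
      · exact hJadj j
      · exact (hJadj j).symm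
    · rintro u v ⟨i, hi, hi'⟩ ⟨j, hj, hj'⟩
      have : i = j := hJinj i j (by rw [hi, hi', hj, hj', Sym2.eq_swap])
      subst this
      exact (hJadj i).ne (hi.trans hj'.symm)
  let φ : J → D.Arc := fun j => ⟨(tail j, head j), j, rfl, rfl⟩
  have hφ : Function.Bijective φ := by
    refine ⟨fun i j h => hJinj i j ?_, ?_⟩
    · have := congrArg Subtype.val h
      simp only [φ, Prod.mk.injEq] at this
      rw [this.1, this.2]
    · rintro ⟨⟨u, v⟩, j, hj, hj'⟩
      exact ⟨j, Subtype.ext (Prod.ext hj hj')⟩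
  let E : J ≃ D.Arc := Equiv.ofBijective φ hφ
  have hcard : Nat.card D.Arc = ∑ i, l i := by
    rw [← Nat.card_congr E, Nat.card_eq_fintype_card, Fintype.card_sigma]
    simp
  let ψ : J → Finset.Icc 1 (Nat.card D.Arc) := fun j => ⟨a j.1 + j.2 + 1, by
    have h1 := hbound j.1
    have h2 := j.2.2
    rw [Finset.mem_Icc, hcard]
    omega⟩
  have hψ : Function.Bijective ψ := by
    rw [Fintype.bijective_iff_injective_and_card]
    constructor
    · rintro ⟨i, p, hp⟩ ⟨j, q, hq⟩ h
      have h := congrArg Subtype.val h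
      simp only [ψ, add_left_inj] at h
      obtain ⟨rfl, rfl⟩ := hlabel i p hp j q hq h
      rfl
    · rw [Fintype.card_coe, Nat.card_Icc, hcard, Fintype.card_sigma]
      simp
  let c : D.Labeling := E.symm.trans (Equiv.ofBijective ψ hψ)
  have hc : ∀ j, ((c (E j) : ℕ) : ℤ) = a j.1 + (j.2 : ℕ) + 1 := by
    intro j
    simp [c, ψ]
  have hv : ∀ v, D.vertexSum c v = ∑ i, ∑ p ∈ Finset.range (l i), ((a i : ℤ) + p + 1) *
      ((if x i (p + 1) = v then 1 else 0) - if x i p = v then 1 else 0) := by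
    intro v
    unfold Digraph.vertexSum
    rw [Finset.sum_filter, Finset.sum_filter, ← Finset.sum_sub_distrib]
    trans ∑ j : J, ((if head j = v then ((c (E j) : ℕ) : ℤ) else 0) -
      if tail j = v then ((c (E j) : ℕ) : ℤ) else 0)
    · symm
      exact Finset.sum_equiv E (by simp) fun j _ => rfl
    rw [Fintype.sum_sigma]
    refine Finset.sum_congr rfl fun i _ => ?_
    rw [Finset.sum_range]
    refine Finset.sum_congr rfl fun p _ => ?_
    rw [hc]
    change (if x i (p + 1) = v then _ else _) - (if x i p = v then _ else _) = _
    split_ifs <;> simp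
  have hdeg : ∀ v, ∑ i, ∑ p ∈ Finset.range (l i), ((if x i p = v then (1 : ℤ) else 0) +
      if x i (p + 1) = v then 1 else 0) = k := by
    intro v
    rw [← hreg.degree_eq v, ← G.sum_incidences_eq_degree tail head hJadj hJinj hJsurj v,
      Fintype.sum_sigma]
    exact Finset.sum_congr rfl fun i _ => by rw [Finset.sum_range]
  have key : ∀ v, (∑ i, if x i (l i) = v then 2 * ((a i : ℤ) + l i) + 1 else 0) -
      ∑ i, (if x i 0 = v then 2 * (a i : ℤ) + 1 else 0) = 2 * D.vertexSum c v + k := by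
    intro v
    rw [hv v, ← hdeg v, Finset.mul_sum, ← Finset.sum_add_distrib, ← Finset.sum_sub_distrib]
    refine Finset.sum_congr rfl fun i _ => ?_
    rw [two_mul_sum_range_mul_sub (a i : ℤ) (fun p => if x i p = v then 1 else 0)]
    simp
  refine ⟨D, hD, c, fun u v huv => hsum ?_⟩
  simp only [key, huv]

/-! ### Euler tours -/

namespace SimpleGraph

variable {V : Type*} {G : SimpleGraph V}

/-- An open trail can be extended at its end if all degrees are even. -/
theorem Walk.IsTrail.exists_adj_notMem_edges [Fintype V] [DecidableRel G.Adj]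
    (heven : ∀ v, Even (G.degree v)) {u v : V} {p : G.Walk u v} (hp : p.IsTrail) (huv : u ≠ v) :
    ∃ w, G.Adj v w ∧ s(v, w) ∉ p.edges := by
  classical
  by_contra! h
  have h1 : ¬ Even (p.edges.countP fun e => v ∈ e) := by
    rw [hp.even_countP_edges_iff]
    simp [huv]
  apply h1
  have h2 : p.edges.countP (fun e => v ∈ e) = G.degree v := by
    rw [List.countP_eq_length_filter, ← List.toFinset_card_of_nodup (hp.edges_nodup.filter _),
      ← G.card_incidenceFinset_eq_degree]
    congr 1
    ext e
    simp only [List.mem_toFinset, List.mem_filter, decide_eq_true_eq, mem_incidenceFinset]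
    constructor
    · rintro ⟨he, hv⟩
      exact ⟨p.edges_subset_edgeSet he, hv⟩
    · rintro ⟨he, hv⟩
      obtain ⟨w, rfl⟩ := hv
      exact ⟨h w he, Sym2.mem_mk_left _ _⟩
  rw [h2]
  exact heven v

/-- Euler's theorem for one component. A longest trail is closed, as it could be extended otherwise,
and it uses every edge at each of its vertices, as it could be rotated and extended otherwise. -/
theorem exists_closed_trail_of_even_degree [Fintype V] [DecidableRel G.Adj]
    (heven : ∀ v, Even (G.degree v)) (C : G.ConnectedComponent) :
    ∃ (u : V) (p : G.Walk u u), u ∈ C.supp ∧ p.IsTrail ∧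
      ∀ v w, v ∈ C.supp → G.Adj v w → s(v, w) ∈ p.edges := by
  classical
  let P : ℕ → Prop := fun n => ∃ (u v : V) (p : G.Walk u v), u ∈ C.supp ∧ p.IsTrail ∧ p.length = n
  have hP : ∃ n, P n := by
    obtain ⟨u, hu⟩ := C.nonempty_supp
    exact ⟨0, u, u, .nil, hu, by simp, rfl⟩
  have hb : ∀ n, P n → n ≤ G.edgeFinset.card := by
    rintro n ⟨u, v, p, -, hp, rfl⟩
    exact hp.length_le_card_edgeFinset
  obtain ⟨n0, hn0⟩ := hP
  have hmax := Nat.findGreatest_spec (P := P) (hb n0 hn0) hn0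
  obtain ⟨u, v, p, hu, hp, hlen⟩ := hmax
  have hlong : ∀ (u' v' : V) (q : G.Walk u' v'), u' ∈ C.supp → q.IsTrail → q.length ≤ p.length := by
    intro u' v' q hu' hq
    rw [hlen]
    exact Nat.le_findGreatest (hb _ ⟨_, _, q, hu', hq, rfl⟩) ⟨_, _, q, hu', hq, rfl⟩
  -- a longest trail is closed
  have huv : u = v := by
    by_contra huv
    obtain ⟨w, hw, hw'⟩ := hp.exists_adj_notMem_edges heven huv
    have hq : (p.concat hw).IsTrail := by
      rw [Walk.isTrail_def, Walk.edges_concat, List.concat_eq_append, List.nodup_append]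
      refine ⟨hp.edges_nodup, by simp, ?_⟩
      intro a ha b hb hab
      rw [List.mem_singleton] at hb
      subst hab hb
      exact hw' ha
    have := hlong _ _ _ hu hq
    simp at this
  subst huv
  -- no edge at a vertex of the trail is missing
  have hsupp : ∀ v ∈ p.support, ∀ w, G.Adj v w → s(v, w) ∈ p.edges := by
    intro v hv w hvw
    by_contra hmem
    have hq : (Walk.cons hvw.symm (p.rotate v hv)).IsTrail := by
      rw [Walk.isTrail_cons]
      refine ⟨hp.rotate hv, fun h => hmem ?_⟩
      rw [Sym2.eq_swap]
      exact (p.rotate_edges v hv).mem_iff.1 h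
    have hw : w ∈ C.supp := by
      have h1 : G.Reachable u v := ⟨p.takeUntil v hv⟩
      rw [ConnectedComponent.mem_supp_iff] at hu ⊢
      rw [← hu]
      exact (ConnectedComponent.sound (h1.trans hvw.reachable)).symm
    have := hlong _ _ _ hw hq
    simp at this
  have hall : ∀ v, G.Reachable u v → v ∈ p.support := by
    rintro v ⟨q⟩
    have : ∀ (a b : V) (q : G.Walk a b), a ∈ p.support → b ∈ p.support := by
      intro a b q
      induction q with
      | nil => exact id
      | cons h q ih => exact fun ha => ih (p.snd_mem_support_of_mem_edges (hsupp _ ha _ h))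
    exact this _ _ q p.start_mem_support
  refine ⟨u, p, hu, hp, fun v w hv hvw => hsupp v (hall v ?_) w hvw⟩
  rw [ConnectedComponent.mem_supp_iff] at hu hv
  exact ConnectedComponent.exact (hu.trans hv.symm)

end SimpleGraph

/-! ### Cutting an Euler tour at one visit of each vertex -/

theorem exists_lt_and_mem_Ico_of_le (t : ℕ → ℕ) {n p : ℕ} (h0 : t 0 ≤ p) (hn : p < t n) :
    ∃ i < n, t i ≤ p ∧ p < t (i + 1) := by
  induction n with
  | zero => omega
  | succ n ih =>
    by_cases h : p < t n
    · obtain ⟨i, hi, h⟩ := ih h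
      exact ⟨i, by omega, h⟩
    · exact ⟨n, by omega, by omega, hn⟩

namespace SimpleGraph.ConnectedComponent

variable {V : Type*} {G : SimpleGraph V}

/-- An Euler tour of the component `C`, as a periodic sequence `vert` of vertices, with one
distinguished visit to each vertex: `cut 0 < cut 1 < …` are the times of the distinguished visits,
and one period of the tour contains `C.supp.ncard` of them. All conditions are stated modulo the
period, so that they are invariant under shifting the numbering of the cuts. -/
structure SplitTour (C : G.ConnectedComponent) where
  vert : ℕ → V
  length : ℕ
  cut : ℕ → ℕ
  length_pos : 0 < length
  vert_periodic : Function.Periodic vert length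
  cut_strictMono : StrictMono cut
  cut_add : ∀ i, cut (i + C.supp.ncard) = cut i + length
  vert_mem : ∀ p, vert p ∈ C.supp
  adj : ∀ p, G.Adj (vert p) (vert (p + 1))
  edge_inj : ∀ p q, s(vert p, vert (p + 1)) = s(vert q, vert (q + 1)) → p ≡ q [MOD length]
  edge_surj : ∀ v w, v ∈ C.supp → G.Adj v w → ∃ p, s(vert p, vert (p + 1)) = s(v, w)
  cut_inj : ∀ i j, vert (cut i) = vert (cut j) → i ≡ j [MOD C.supp.ncard]
  cut_surj : ∀ v ∈ C.supp, ∃ i, vert (cut i) = v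

theorem nonempty_splitTour [Fintype V] [DecidableRel G.Adj] (heven : ∀ v, Even (G.degree v))
    (hpos : ∀ v, 0 < G.degree v) (C : G.ConnectedComponent) : Nonempty C.SplitTour := by
  classical
  obtain ⟨u, p, hu, hp, hall⟩ := exists_closed_trail_of_even_degree heven C
  set m := p.length with hm
  set n := C.supp.ncard with hn
  have hnpos : 0 < n := by
    rw [hn, Set.ncard_pos]
    exact C.nonempty_supp
  have hedge : ∀ v w, v ∈ C.supp → G.Adj v w →
      ∃ i < m, s(p.getVert i, p.getVert (i + 1)) = s(v, w) := fun v w hv hvw =>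
    p.mk_mem_edges_iff_exists.1 (hall v w hv hvw)
  have hmpos : 0 < m := by
    obtain ⟨w, hw⟩ := (G.degree_pos_iff_exists_adj u).1 (hpos u)
    obtain ⟨i, hi, -⟩ := hedge u w hu hw
    omega
  -- the closed trail, repeated periodically
  let x : ℕ → V := fun i => p.getVert (i % m)
  have hx : Function.Periodic x m := fun i => by simp [x]
  have hx0 : ∀ i ≤ m, x i = p.getVert i := by
    intro i hi
    rcases hi.lt_or_eq with hi | rfl
    · simp only [x, Nat.mod_eq_of_lt hi]
    · simp [x, hm]
  have hxmod : ∀ i, x (i % m) = x i := fun i => hx.map_mod_nat i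
  have hxmod' : ∀ i, x (i % m + 1) = x (i + 1) := fun i => by
    rw [← hxmod (i % m + 1), ← hxmod (i + 1)]
    congr 1
    simp [Nat.add_mod]
  have hxadj : ∀ i, G.Adj (x i) (x (i + 1)) := by
    intro i
    have hi := Nat.mod_lt i hmpos
    rw [← hxmod i, ← hxmod' i, hx0 _ hi.le, hx0 _ hi]
    exact p.adj_getVert_succ hi
  have hxmem : ∀ i, x i ∈ C.supp := by
    intro i
    rw [mem_supp_iff] at hu ⊢
    rw [← hu]
    exact (ConnectedComponent.sound (p.take (i % m)).reachable).symm
  have hinj : ∀ i j, s(x i, x (i + 1)) = s(x j, x (j + 1)) → i ≡ j [MOD m] := by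
    intro i j h
    have hi := Nat.mod_lt i hmpos
    have hj := Nat.mod_lt j hmpos
    rw [← hxmod i, ← hxmod' i, ← hxmod j, ← hxmod' j, hx0 _ hi.le, hx0 _ hi, hx0 _ hj.le,
      hx0 _ hj, ← Walk.getElem_edges (by simpa using hi),
      ← Walk.getElem_edges (by simpa using hj)] at h
    exact (hp.edges_nodup.getElem_inj_iff).1 h
  have hvis : ∀ v : V, ∃ i, v ∈ C.supp → i < m ∧ x i = v := by
    intro v
    by_cases hv : v ∈ C.supp
    · obtain ⟨w, hw⟩ := (G.degree_pos_iff_exists_adj v).1 (hpos v)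
      obtain ⟨i, hi, h⟩ := hedge v w hv hw
      rw [← hx0 i hi.le, ← hx0 (i + 1) hi] at h
      rcases Sym2.eq_iff.1 h with h | h
      · exact ⟨i, fun _ => ⟨hi, h.1⟩⟩
      · exact ⟨(i + 1) % m, fun _ => ⟨Nat.mod_lt _ hmpos, by rw [hxmod, h.2]⟩⟩
    · exact ⟨0, fun h => absurd h hv⟩
  -- `f v` is one time at which the tour visits `v`
  choose f hf using hvis
  let B : Finset ℕ := C.supp.toFinset.image f
  have hB : B.card = n := by
    rw [Finset.card_image_of_injOn, hn, Set.ncard_eq_toFinset_card']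
    intro v hv w hw h
    simp only [Set.coe_toFinset] at hv hw
    rw [← (hf v hv).2, ← (hf w hw).2, h]
  have hBmem : ∀ b ∈ B, b < m ∧ f (x b) = b := by
    intro b hb
    obtain ⟨v, hv, rfl⟩ := Finset.mem_image.1 hb
    rw [Set.mem_toFinset] at hv
    exact ⟨(hf v hv).1, by rw [(hf v hv).2]⟩
  let g : ℕ → ℕ := fun i => B.orderEmbOfFin hB ⟨i % n, Nat.mod_lt _ hnpos⟩
  have hgB : ∀ i, g i ∈ B := fun i => B.orderEmbOfFin_mem hB _
  have hgm : ∀ i, g i < m := fun i => (hBmem _ (hgB i)).1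
  have hglt : ∀ i j, i % n < j % n → g i < g j := fun i j h =>
    (B.orderEmbOfFin hB).strictMono h
  let t : ℕ → ℕ := fun i => m * (i / n) + g i
  have hxt : ∀ i, x (t i) = x (g i) := by
    intro i
    rw [← hxmod (t i), ← hxmod (g i)]
    simp [t, Nat.add_mod]
  refine ⟨⟨x, m, t, hmpos, hx, ?_, ?_, hxmem, hxadj, hinj, ?_, ?_, ?_⟩⟩
  · refine strictMono_nat_of_lt_succ fun i => ?_
    have h1 := Nat.div_add_mod i n
    have h2 := Nat.div_add_mod (i + 1) n
    have h3 := Nat.mod_lt i hnpos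
    have h4 := Nat.mod_lt (i + 1) hnpos
    by_cases h : i % n + 1 < n
    · have h5 : (i + 1) % n = i % n + 1 := by
        rw [Nat.add_mod, Nat.mod_eq_of_lt (show 1 < n by omega), Nat.mod_eq_of_lt h]
      have h6 : (i + 1) / n = i / n := by
        apply Nat.eq_of_mul_eq_mul_left hnpos
        omega
      have := hglt i (i + 1) (by omega)
      simp only [t, h6]
      omega
    · have h6 : (i + 1) / n = i / n + 1 := by
        rw [Nat.succ_div, if_pos]
        exact ⟨i / n + 1, by rw [mul_add]; omega⟩
      have := hgm i
      simp only [t, h6, mul_add]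
      omega
  · intro i
    have hg : g (i + n) = g i := by simp only [g, Nat.add_mod_right]
    change m * ((i + n) / n) + g (i + n) = m * (i / n) + g i + m
    rw [Nat.add_div_right _ hnpos, hg]
    ring
  · intro v w hv hvw
    obtain ⟨i, hi, h⟩ := hedge v w hv hvw
    exact ⟨i, by rw [hx0 i hi.le, hx0 (i + 1) hi, h]⟩
  · intro i j h
    rw [hxt, hxt] at h
    have h1 : g i = g j := by
      rw [← (hBmem _ (hgB i)).2, ← (hBmem _ (hgB j)).2, h]
    have := (B.orderEmbOfFin hB).injective h1
    exact congrArg Fin.val this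
  · intro v hv
    have hfv : f v ∈ B := Finset.mem_image.2 ⟨v, by simpa using hv, rfl⟩
    have : f v ∈ Set.range (B.orderEmbOfFin hB) := by
      rw [B.range_orderEmbOfFin hB]
      exact hfv
    obtain ⟨⟨i, hi⟩, h⟩ := this
    refine ⟨i, ?_⟩
    rw [hxt]
    simp only [g, Nat.mod_eq_of_lt hi, h]
    exact (hf v hv).2

namespace SplitTour

variable {C : G.ConnectedComponent} (T : C.SplitTour)

theorem ncard_pos (T : C.SplitTour) : 0 < C.supp.ncard := by
  rcases Nat.eq_zero_or_pos C.supp.ncard with h | h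
  · have h1 := T.cut_add 0
    have h2 := T.length_pos
    rw [h, add_zero] at h1
    omega
  · exact h

theorem vert_cut_periodic : Function.Periodic (fun i => T.vert (T.cut i)) C.supp.ncard :=
  fun i => by
    simp only [T.cut_add]
    exact T.vert_periodic _

/-- The same tour with the cuts renumbered from the `c`-th one on. -/
def shift (c : ℕ) : C.SplitTour where
  vert := T.vert
  length := T.length
  cut i := T.cut (i + c)
  length_pos := T.length_pos
  vert_periodic := T.vert_periodic
  cut_strictMono _ _ h := T.cut_strictMono (by omega)
  cut_add i := by rw [← T.cut_add, add_right_comm]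
  vert_mem := T.vert_mem
  adj := T.adj
  edge_inj := T.edge_inj
  edge_surj := T.edge_surj
  cut_inj i j h := (T.cut_inj _ _ h).add_right_cancel' c
  cut_surj v hv := by
    obtain ⟨i, hi⟩ := T.cut_surj v hv
    refine ⟨i + C.supp.ncard * c - c, ?_⟩
    have h1 : c ≤ C.supp.ncard * c := Nat.le_mul_of_pos_left c T.ncard_pos
    rw [Nat.sub_add_cancel (by omega), mul_comm]
    exact (T.vert_cut_periodic.nat_mul c i).trans hi

theorem cut_ncard : T.cut C.supp.ncard = T.cut 0 + T.length := by
  simpa using T.cut_add 0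

theorem vert_eq_of_modEq {p q : ℕ} (h : p ≡ q [MOD T.length]) : T.vert p = T.vert q := by
  rw [← T.vert_periodic.map_mod_nat p, ← T.vert_periodic.map_mod_nat q, h]

theorem cut_index_inj {i j : ℕ} (hi : i < C.supp.ncard) (hj : j < C.supp.ncard)
    (h : T.vert (T.cut i) = T.vert (T.cut j)) : i = j :=
  (T.cut_inj i j h).eq_of_lt_of_lt hi hj

theorem exists_cut_lt {v : V} (hv : v ∈ C.supp) :
    ∃ i < C.supp.ncard, T.vert (T.cut i) = v := by
  obtain ⟨i, hi⟩ := T.cut_surj v hv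
  exact ⟨i % C.supp.ncard, Nat.mod_lt _ T.ncard_pos,
    (T.vert_cut_periodic.map_mod_nat i).trans hi⟩

theorem length_le [Fintype V] [DecidableRel G.Adj] {k : ℕ} (hreg : G.IsRegularOfDegree k) :
    T.length ≤ C.supp.ncard * k := by
  classical
  have h1 : (Finset.range T.length).card ≤
      (C.supp.toFinset.sigma fun v => G.neighborFinset v).card := by
    refine Finset.card_le_card_of_injOn (fun p => ⟨T.vert p, T.vert (p + 1)⟩) ?_ ?_
    · intro p _
      simp only [Finset.coe_sigma, Set.mem_sigma_iff, Finset.mem_coe, Set.mem_toFinset,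
        mem_neighborFinset]
      exact ⟨T.vert_mem p, T.adj p⟩
    · intro p hp q hq h
      simp only [Sigma.mk.injEq, heq_eq_eq] at h
      simp only [Finset.coe_range, Set.mem_Iio] at hp hq
      exact (T.edge_inj p q (by rw [h.1, h.2])).eq_of_lt_of_lt hp hq
  rw [Finset.card_range, Finset.card_sigma,
    Finset.sum_congr rfl fun v _ => (G.card_neighborFinset_eq_degree v).trans (hreg.degree_eq v)]
    at h1
  simpa [Set.ncard_eq_toFinset_card'] using h1

theorem cut_mul_ncard (j : ℕ) : T.cut (j * C.supp.ncard) = T.cut 0 + j * T.length := by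
  induction j with
  | zero => simp
  | succ j ih => rw [add_mul, one_mul, T.cut_add, ih]; ring

/-- If the average gap between consecutive cuts is at most `b`, then some `K` consecutive gaps
have total length at most `K * b`. -/
theorem exists_short_window {b : ℕ} (hb : T.length ≤ C.supp.ncard * b) (K : ℕ) :
    ∃ c, T.cut (c + K) ≤ T.cut c + K * b := by
  by_contra! h
  -- otherwise all the windows starting at multiples of `K` are too long, while
  -- `C.supp.ncard` of them make up exactly `K` periods
  have h1 : ∀ j, T.cut 0 + j * (K * b + 1) ≤ T.cut (j * K) := by
    intro j
    induction j with
    | zero => simp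
    | succ j ih =>
      have := h (j * K)
      rw [add_mul, one_mul, add_mul, one_mul]
      omega
  have h2 := h1 C.supp.ncard
  rw [mul_comm _ K, T.cut_mul_ncard] at h2
  have h3 : K * T.length ≤ K * (C.supp.ncard * b) := Nat.mul_le_mul_left K hb
  have h4 := T.ncard_pos
  have h5 : C.supp.ncard * (K * b + 1) = K * (C.supp.ncard * b) + C.supp.ncard := by ring
  omega

end SplitTour

end SimpleGraph.ConnectedComponent

/-! ### Arranging the label intervals of a component -/

/-- The predecessor of `i` in the cyclic order of `0, …, n - 1`. -/
def cyclicPred (n i : ℕ) : ℕ := if i = 0 then n - 1 else i - 1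

/-- `n` segments, of lengths `l i`, in cyclic order, placed in disjoint intervals
`[a i, a i + l i)` of labels, in such a way that no two sources have the same sum of interval
starts, and no two sinks the same sum of interval ends. Vertex `k` lies between the segments
`cyclicPred n k` and `k`; it is a sink for odd `k` and a source for even `k`, except that for odd
`n` vertex `0` is neither. -/
structure IsArrangement (n : ℕ) (l a : ℕ → ℕ) : Prop where
  add_le : ∀ i < n, a i + l i ≤ ∑ j ∈ Finset.range n, l j
  disjoint : ∀ i < n, ∀ j < n, i ≠ j → a i + l i ≤ a j ∨ a j + l j ≤ a i
  source_ne : ∀ i < n, ∀ j < n, i ≠ j → i % 2 = 0 → j % 2 = 0 → (i = 0 ∨ j = 0 → n % 2 = 0) →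
    a (cyclicPred n i) + a i ≠ a (cyclicPred n j) + a j
  sink_ne : ∀ i < n, ∀ j < n, i ≠ j → i % 2 = 1 → j % 2 = 1 →
    a (i - 1) + l (i - 1) + (a i + l i) ≠ a (j - 1) + l (j - 1) + (a j + l j)

/-- The start of the interval of `i` when the intervals are laid out by increasing `key`. -/
def keyOffset {ι : Type*} (s : Finset ι) (l key : ι → ℕ) (i : ι) : ℕ :=
  ∑ j ∈ s with key j < key i, l j

theorem keyOffset_add_le_sum {ι : Type*} {s : Finset ι} {i : ι} (l key : ι → ℕ) (hi : i ∈ s) :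
    keyOffset s l key i + l i ≤ ∑ j ∈ s, l j := by
  classical
  unfold keyOffset
  rw [add_comm, ← Finset.sum_insert (by simp)]
  refine Finset.sum_le_sum_of_subset fun j hj => ?_
  rw [Finset.mem_insert, Finset.mem_filter] at hj
  rcases hj with rfl | hj
  · exact hi
  · exact hj.1

theorem keyOffset_add_le {ι : Type*} {s : Finset ι} {i j : ι} (l key : ι → ℕ) (hi : i ∈ s)
    (h : key i < key j) : keyOffset s l key i + l i ≤ keyOffset s l key j := by
  classical
  unfold keyOffset
  rw [add_comm, ← Finset.sum_insert (by simp)]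
  refine Finset.sum_le_sum_of_subset fun k hk => ?_
  rw [Finset.mem_insert, Finset.mem_filter] at hk
  rw [Finset.mem_filter]
  rcases hk with rfl | hk
  · exact ⟨hi, h⟩
  · exact ⟨hk.1, hk.2.trans h⟩

/-- The pair `{p', q'}` dominates the pair `{p, q}` in the order given by `key`: componentwise under
one of the two matchings of the pairs, and strictly in at least one component. -/
def KeyDominated (key : ℕ → ℕ) (p q p' q' : ℕ) : Prop :=
  key p + key q < key p' + key q' ∧
    (key p ≤ key p' ∧ key q ≤ key q' ∨ key p ≤ key q' ∧ key q ≤ key p')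

theorem KeyDominated.add_lt_add {n : ℕ} {key φ : ℕ → ℕ} {p q p' q' : ℕ}
    (hkey : ∀ i < n, ∀ j < n, key i = key j → i = j)
    (hφ : ∀ i < n, ∀ j < n, key i < key j → φ i < φ j) (hp : p < n) (hq : q < n)
    (hp' : p' < n) (hq' : q' < n) (h : KeyDominated key p q p' q') : φ p + φ q < φ p' + φ q' := by
  have hle : ∀ i < n, ∀ j < n, key i ≤ key j → φ i ≤ φ j := by
    intro i hi j hj hij
    rcases hij.lt_or_eq with hij | hij
    · exact (hφ i hi j hj hij).le
    · rw [hkey i hi j hj hij]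
  obtain ⟨h0, ⟨h1, h2⟩ | ⟨h1, h2⟩⟩ := h
  · have h3 := hle _ hp _ hp' h1
    have h4 := hle _ hq _ hq' h2
    rcases h1.lt_or_eq with h1 | h1
    · have := hφ _ hp _ hp' h1
      omega
    · have := hφ _ hq _ hq' (by omega)
      omega
  · have h3 := hle _ hp _ hq' h1
    have h4 := hle _ hq _ hp' h2
    rcases h1.lt_or_eq with h1 | h1
    · have := hφ _ hp _ hq' h1
      omega
    · have := hφ _ hq _ hp' (by omega)
      omega

/-- Laying out the segments by a key gives an arrangement if, of any two sources or sinks, one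
dominates the other: both ends of the intervals increase strictly with the key. -/
theorem isArrangement_keyOffset {n : ℕ} {l key : ℕ → ℕ} (hl : ∀ i, 0 < l i)
    (hkey : ∀ i < n, ∀ j < n, key i = key j → i = j)
    (hdom : ∀ i < n, ∀ j < n, i ≠ j → i % 2 = j % 2 → (i = 0 ∨ j = 0 → n % 2 = 0) →
      KeyDominated key (cyclicPred n i) i (cyclicPred n j) j ∨
        KeyDominated key (cyclicPred n j) j (cyclicPred n i) i) :
    IsArrangement n l (keyOffset (Finset.range n) l key) := by
  have hstart : ∀ i < n, ∀ j < n, key i < key j →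
      keyOffset (Finset.range n) l key i < keyOffset (Finset.range n) l key j := by
    intro i hi j _ h
    have := keyOffset_add_le l key (Finset.mem_range.2 hi) h
    have := hl i
    omega
  have hend : ∀ i < n, ∀ j < n, key i < key j →
      keyOffset (Finset.range n) l key i + l i < keyOffset (Finset.range n) l key j + l j := by
    intro i hi j _ h
    have := keyOffset_add_le l key (Finset.mem_range.2 hi) h
    have := hl j
    omega
  have hpred : ∀ i < n, cyclicPred n i < n := by
    intro i hi
    unfold cyclicPred
    split_ifs <;> omega
  refine ⟨fun i hi => keyOffset_add_le_sum l key (Finset.mem_range.2 hi), ?_, ?_, ?_⟩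
  · intro i hi j hj hij
    rcases lt_trichotomy (key i) (key j) with h | h | h
    · exact Or.inl (keyOffset_add_le l key (Finset.mem_range.2 hi) h)
    · exact absurd (hkey i hi j hj h) hij
    · exact Or.inr (keyOffset_add_le l key (Finset.mem_range.2 hj) h)
  · intro i hi j hj hij h1 h2 h3
    rcases hdom i hi j hj hij (by omega) h3 with h | h
    · exact (h.add_lt_add hkey hstart (hpred i hi) hi (hpred j hj) hj).ne
    · exact (h.add_lt_add hkey hstart (hpred j hj) hj (hpred i hi) hi).ne'
  · intro i hi j hj hij h1 h2
    have hpi : i - 1 = cyclicPred n i := by unfold cyclicPred; rw [if_neg (by omega)]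
    have hpj : j - 1 = cyclicPred n j := by unfold cyclicPred; rw [if_neg (by omega)]
    rw [hpi, hpj]
    rcases hdom i hi j hj hij (by omega) (by omega) with h | h
    · exact (h.add_lt_add (φ := fun i => keyOffset (Finset.range n) l key i + l i) hkey hend
        (hpred i hi) hi (hpred j hj) hj).ne
    · exact (h.add_lt_add (φ := fun i => keyOffset (Finset.range n) l key i + l i) hkey hend
        (hpred j hj) hj (hpred i hi) hi).ne'

/-- The order `0, 1, …, r, n - 1, r + 1, n - 2, r + 2, …`, which takes segments alternately from
both sides of vertex `0` after a head start of `r` on one side. -/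
def tentKey (n r i : ℕ) : ℕ := min (2 * i) (2 * (n - 1 - i) + 2 * r + 1)

/-- For even `n` vertex `0` is a source, between the segments `n - 1` and `0`, and these must then
be the two lowest ones, whence the condition on `r`. -/
theorem isArrangement_tentKey {n r : ℕ} {l : ℕ → ℕ} (hl : ∀ i, 0 < l i)
    (hr : n % 2 = 0 → r = 0) : IsArrangement n l (keyOffset (Finset.range n) l (tentKey n r)) := by
  refine isArrangement_keyOffset hl ?_ ?_
  · intro i hi j hj h
    unfold tentKey at h
    omega
  · intro i hi j hj hij h1 h2
    unfold KeyDominated tentKey cyclicPred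
    rcases Nat.eq_zero_or_pos i with rfl | hi0
    · have := hr (h2 (Or.inl rfl))
      subst this
      rw [if_pos rfl, if_neg (by omega)]
      omega
    · rcases Nat.eq_zero_or_pos j with rfl | hj0
      · have := hr (h2 (Or.inr rfl))
        subst this
        rw [if_pos rfl, if_neg (by omega)]
        omega
      · rw [if_neg (by omega), if_neg (by omega)]
        rcases lt_or_gt_of_ne hij with hij | hij <;> omega

theorem keyOffset_tentKey_zero (n r : ℕ) (l : ℕ → ℕ) :
    keyOffset (Finset.range n) l (tentKey n r) 0 = 0 := by
  simp [keyOffset, tentKey]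

theorem keyOffset_tentKey_last {n r : ℕ} (l : ℕ → ℕ) (h : r + 2 ≤ n) :
    keyOffset (Finset.range n) l (tentKey n r) (n - 1) = ∑ j ∈ Finset.range (r + 1), l j := by
  unfold keyOffset
  congr 1
  ext j
  rw [Finset.mem_filter]
  simp only [Finset.mem_range, tentKey]
  omega

/-- The order `0, 2, 4, …, 1, 3, 5, …`. -/
def tierKey (n i : ℕ) : ℕ := if i % 2 = 0 then i else n + i

theorem isArrangement_tierKey {n : ℕ} {l : ℕ → ℕ} (hl : ∀ i, 0 < l i) (hn : n % 2 = 1) :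
    IsArrangement n l (keyOffset (Finset.range n) l (tierKey n)) := by
  refine isArrangement_keyOffset hl ?_ ?_
  · intro i hi j hj h
    unfold tierKey at h
    split_ifs at h <;> omega
  · intro i hi j hj hij h1 h2
    unfold KeyDominated tierKey cyclicPred
    rw [if_neg (show ¬ i = 0 by omega), if_neg (show ¬ j = 0 by omega)]
    split_ifs <;> omega

theorem keyOffset_tierKey_zero (n : ℕ) (l : ℕ → ℕ) :
    keyOffset (Finset.range n) l (tierKey n) 0 = 0 := by
  simp [keyOffset, tierKey]

theorem le_keyOffset_tierKey_last {n : ℕ} {l : ℕ → ℕ} (hl : ∀ i, 0 < l i) (hn : n % 2 = 1) :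
    n / 2 + 1 ≤ keyOffset (Finset.range n) l (tierKey n) (n - 1) + l (n - 1) := by
  -- each of the segments `0, 2, …, 2 * i` has length at least `1`
  have h : ∀ i, 2 * i < n →
      i + 1 ≤ keyOffset (Finset.range n) l (tierKey n) (2 * i) + l (2 * i) := by
    intro i
    induction i with
    | zero => intro _; have := hl (2 * 0); omega
    | succ i ih =>
      intro hi
      have h1 := ih (by omega)
      have h2 : keyOffset (Finset.range n) l (tierKey n) (2 * i) + l (2 * i) ≤
          keyOffset (Finset.range n) l (tierKey n) (2 * (i + 1)) := by
        refine keyOffset_add_le l _ (Finset.mem_range.2 (by omega)) ?_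
        unfold tierKey
        split_ifs <;> omega
      have h3 := hl (2 * (i + 1))
      omega
  have := h (n / 2) (by omega)
  rwa [show 2 * (n / 2) = n - 1 by omega] at this

theorem keyOffset_tierKey_last_lt {n k : ℕ} {l : ℕ → ℕ} (hl : ∀ i, 0 < l i) (hn : n % 2 = 1)
    (hk : k % 2 = 1) :
    keyOffset (Finset.range n) l (tierKey n) (n - 1) + l (n - 1) <
      keyOffset (Finset.range n) l (tierKey n) k + l k := by
  have h : keyOffset (Finset.range n) l (tierKey n) (n - 1) + l (n - 1) ≤
      keyOffset (Finset.range n) l (tierKey n) k := by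
    refine keyOffset_add_le l _ (Finset.mem_range.2 (by omega)) ?_
    unfold tierKey
    split_ifs <;> omega
  have := hl k
  omega

/-! ### Sums over the ends of the segments -/

/-- The index of the vertex at which segment `i` ends: segment `i` joins the vertices `i` and
`i + 1` (cyclically), and is directed from `i` to `i + 1` exactly when `i` is even. -/
def segmentTarget (n i : ℕ) : ℕ := if i % 2 = 0 then if i + 1 = n then 0 else i + 1 else i

/-- The index of the vertex at which segment `i` starts; see `segmentTarget`. -/
def segmentSource (n i : ℕ) : ℕ := if i % 2 = 0 then i else if i + 1 = n then 0 else i + 1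

/-- The contribution of the ends of the `n` segments to twice the (shifted) sum at vertex `k`. -/
def blockSum (n : ℕ) (l a : ℕ → ℕ) (k : ℕ) : ℤ :=
  (∑ i ∈ Finset.range n, if segmentTarget n i = k then 2 * ((a i : ℤ) + l i) + 1 else 0) -
    ∑ i ∈ Finset.range n, if segmentSource n i = k then 2 * (a i : ℤ) + 1 else 0

theorem blockSum_sink {n k : ℕ} (l a : ℕ → ℕ) (hk : k < n) (hodd : k % 2 = 1) :
    blockSum n l a k = 2 * (a (k - 1) + l (k - 1) + (a k + l k) + 1) := by
  unfold blockSum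
  rw [← Finset.sum_filter, ← Finset.sum_filter]
  have h1 : (Finset.range n).filter (fun i => segmentTarget n i = k) = {k - 1, k} := by
    ext i
    rw [Finset.mem_filter]
    simp only [Finset.mem_range, Finset.mem_insert, Finset.mem_singleton, segmentTarget]
    split_ifs <;> omega
  have h2 : (Finset.range n).filter (fun i => segmentSource n i = k) = ∅ := by
    ext i
    rw [Finset.mem_filter]
    simp only [Finset.mem_range, Finset.notMem_empty, iff_false, segmentSource]
    split_ifs <;> omega
  rw [h1, h2, Finset.sum_pair (by omega), Finset.sum_empty]
  ring

theorem blockSum_source {n k : ℕ} (l a : ℕ → ℕ) (hk : k < n) (heven : k % 2 = 0)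
    (h0 : k = 0 → n % 2 = 0) : blockSum n l a k = -(2 * (a (cyclicPred n k) + a k + 1)) := by
  unfold blockSum
  rw [← Finset.sum_filter, ← Finset.sum_filter]
  have h1 : (Finset.range n).filter (fun i => segmentTarget n i = k) = ∅ := by
    ext i
    rw [Finset.mem_filter]
    simp only [Finset.mem_range, Finset.notMem_empty, iff_false, segmentTarget]
    split_ifs <;> omega
  have h2 : (Finset.range n).filter (fun i => segmentSource n i = k) = {cyclicPred n k, k} := by
    ext i
    rw [Finset.mem_filter]
    simp only [Finset.mem_range, Finset.mem_insert, Finset.mem_singleton, segmentSource,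
      cyclicPred]
    split_ifs <;> omega
  have h3 : cyclicPred n k ≠ k := by
    unfold cyclicPred
    split_ifs <;> omega
  rw [h1, h2, Finset.sum_pair h3, Finset.sum_empty]
  ring

theorem blockSum_zero_of_odd {n : ℕ} (l a : ℕ → ℕ) (hn : n % 2 = 1) :
    blockSum n l a 0 = 2 * (a (n - 1) + l (n - 1) - a 0) := by
  unfold blockSum
  rw [← Finset.sum_filter, ← Finset.sum_filter]
  have h1 : (Finset.range n).filter (fun i => segmentTarget n i = 0) = {n - 1} := by
    ext i
    rw [Finset.mem_filter]
    simp only [Finset.mem_range, Finset.mem_singleton, segmentTarget]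
    split_ifs <;> try simp only [and_true, and_false, false_iff]
    all_goals omega
  have h2 : (Finset.range n).filter (fun i => segmentSource n i = 0) = {0} := by
    ext i
    rw [Finset.mem_filter]
    simp only [Finset.mem_range, Finset.mem_singleton, segmentSource]
    split_ifs <;> try simp only [and_true, and_false, false_iff]
    all_goals omega
  rw [h1, h2, Finset.sum_singleton, Finset.sum_singleton]
  ring

/-- Distinctness of all sums, given an arrangement for every block `c`, disjoint label ranges
starting at `base c`, and exceptional sums `X c` of the odd blocks that are distinct and smaller
than the sum of every sink. -/
theorem blockSum_injective {κ : Type*} {n base X : κ → ℕ} {l a : κ → ℕ → ℕ}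
    (harr : ∀ c, IsArrangement (n c) (l c) (a c)) (hl : ∀ c i, 0 < l c i)
    (hbase : ∀ c c', c ≠ c' → base c + ∑ j ∈ Finset.range (n c), l c j ≤ base c' ∨
      base c' + ∑ j ∈ Finset.range (n c'), l c' j ≤ base c)
    (hX : ∀ c, n c % 2 = 1 → a c 0 + X c = a c (n c - 1) + l c (n c - 1))
    (hXinj : ∀ c c', n c % 2 = 1 → n c' % 2 = 1 → X c = X c' → c = c')
    (hXsink : ∀ c c', n c % 2 = 1 → ∀ k < n c', k % 2 = 1 → X c < 2 * base c' +
      (a c' (k - 1) + l c' (k - 1) + (a c' k + l c' k) + 1))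
    {c c' : κ} {k k' : ℕ} (hk : k < n c) (hk' : k' < n c')
    (h : blockSum (n c) (l c) (fun i => base c + a c i) k =
      blockSum (n c') (l c') (fun i => base c' + a c' i) k') : c = c' ∧ k = k' := by
  -- each vertex is a sink, a source, or the exceptional vertex of an odd block
  have kind : ∀ c, ∀ k < n c, k % 2 = 1 ∨ (k % 2 = 0 ∧ (k = 0 → n c % 2 = 0)) ∨
      (k = 0 ∧ n c % 2 = 1) := by
    intro c k _
    omega
  have hspecial : ∀ c, n c % 2 = 1 →
      blockSum (n c) (l c) (fun i => base c + a c i) 0 = 2 * X c := by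
    intro c hc
    rw [blockSum_zero_of_odd _ _ hc]
    have := hX c hc
    push_cast
    omega
  have hpred : ∀ c, ∀ k < n c, cyclicPred (n c) k < n c := by
    intro c k hk
    unfold cyclicPred
    split_ifs <;> omega
  rcases kind c k hk with hc | ⟨hc, hc0⟩ | ⟨rfl, hc⟩
  · rw [blockSum_sink _ _ hk hc] at h
    rcases kind c' k' hk' with hc' | ⟨hc', hc0'⟩ | ⟨rfl, hc'⟩
    · rw [blockSum_sink _ _ hk' hc'] at h
      push_cast at h
      by_cases hcc : c = c'
      · subst hcc
        refine ⟨rfl, ?_⟩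
        by_contra hne
        have := (harr c).sink_ne k hk k' hk' hne hc hc'
        omega
      · exfalso
        have h1 := (harr c).add_le k hk
        have h2 := (harr c).add_le (k - 1) (by omega)
        have h3 := (harr c').add_le k' hk'
        have h4 := (harr c').add_le (k' - 1) (by omega)
        have h5 := hl c k
        have h6 := hl c' k'
        rcases hbase c c' hcc with hb | hb <;> omega
    · rw [blockSum_source _ _ hk' hc' hc0'] at h
      omega
    · rw [hspecial c' hc'] at h
      have := hXsink c' c hc' k hk hc
      push_cast at h
      omega
  · rw [blockSum_source _ _ hk hc hc0] at h
    rcases kind c' k' hk' with hc' | ⟨hc', hc0'⟩ | ⟨rfl, hc'⟩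
    · rw [blockSum_sink _ _ hk' hc'] at h
      omega
    · rw [blockSum_source _ _ hk' hc' hc0'] at h
      push_cast at h
      by_cases hcc : c = c'
      · subst hcc
        refine ⟨rfl, ?_⟩
        by_contra hne
        have := (harr c).source_ne k hk k' hk' hne hc hc' (by omega)
        omega
      · exfalso
        have h1 := (harr c).add_le k hk
        have h2 := (harr c).add_le _ (hpred c k hk)
        have h3 := (harr c').add_le k' hk'
        have h4 := (harr c').add_le _ (hpred c' k' hk')
        have h5 := hl c k
        have h6 := hl c' k'
        rcases hbase c c' hcc with hb | hb <;> omega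
    · rw [hspecial c' hc'] at h
      omega
  · rw [hspecial c hc] at h
    rcases kind c' k' hk' with hc' | ⟨hc', hc0'⟩ | ⟨rfl, hc'⟩
    · rw [blockSum_sink _ _ hk' hc'] at h
      have := hXsink c c' hc k' hk' hc'
      push_cast at h
      omega
    · rw [blockSum_source _ _ hk' hc' hc0'] at h
      omega
    · rw [hspecial c' hc'] at h
      exact ⟨hXinj c c' hc hc' (by omega), rfl⟩

/-! ### Directed segments of a tour -/

namespace SimpleGraph

namespace ConnectedComponent.SplitTour

variable {V : Type*} {G : SimpleGraph V} {C : G.ConnectedComponent} (T : C.SplitTour)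

/-- The number of edges of segment `i`, which runs between the cuts `i` and `i + 1`. -/
def segLength (i : ℕ) : ℕ := T.cut (i + 1) - T.cut i

/-- The `p`-th vertex of segment `i`, directed along the tour for even `i` and against it for odd
`i`. -/
def segVert (i p : ℕ) : V :=
  if i % 2 = 0 then T.vert (T.cut i + p) else T.vert (T.cut (i + 1) - p)

/-- The position in the tour of the `p`-th edge of segment `i`. -/
def segPos (i p : ℕ) : ℕ :=
  if i % 2 = 0 then T.cut i + p else T.cut (i + 1) - 1 - p

theorem cut_lt_cut_succ (i : ℕ) : T.cut i < T.cut (i + 1) := T.cut_strictMono (by omega)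

theorem segLength_pos (i : ℕ) : 0 < T.segLength i := Nat.sub_pos_of_lt (T.cut_lt_cut_succ i)

theorem sum_segLength (r : ℕ) :
    ∑ i ∈ Finset.range r, T.segLength i = T.cut r - T.cut 0 :=
  Finset.sum_range_tsub T.cut_strictMono.monotone r

theorem segPos_mem {i p : ℕ} (hp : p < T.segLength i) :
    T.cut i ≤ T.segPos i p ∧ T.segPos i p < T.cut (i + 1) := by
  unfold segLength at hp
  unfold segPos
  split_ifs <;> omega

theorem segPos_injOn {i p q : ℕ} (hp : p < T.segLength i) (hq : q < T.segLength i)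
    (h : T.segPos i p = T.segPos i q) : p = q := by
  unfold segLength at hp hq
  unfold segPos at h
  split_ifs at h <;> omega

theorem exists_segPos_eq {i q : ℕ} (h1 : T.cut i ≤ q) (h2 : q < T.cut (i + 1)) :
    ∃ p < T.segLength i, T.segPos i p = q := by
  unfold segLength segPos
  by_cases h : i % 2 = 0
  · exact ⟨q - T.cut i, by omega, by rw [if_pos h]; omega⟩
  · exact ⟨T.cut (i + 1) - 1 - q, by omega, by rw [if_neg h]; omega⟩

theorem segEdge {i p : ℕ} (hp : p < T.segLength i) : s(T.segVert i p, T.segVert i (p + 1)) =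
    s(T.vert (T.segPos i p), T.vert (T.segPos i p + 1)) := by
  unfold segLength at hp
  unfold segVert segPos
  split_ifs with h
  · rfl
  · rw [show T.cut (i + 1) - 1 - p + 1 = T.cut (i + 1) - p by omega, Sym2.eq_swap,
      show T.cut (i + 1) - 1 - p = T.cut (i + 1) - (p + 1) by omega]

theorem segVert_mem (i p : ℕ) : T.segVert i p ∈ C.supp := by
  unfold segVert
  split_ifs <;> exact T.vert_mem _

theorem segVert_adj {i p : ℕ} (hp : p < T.segLength i) :
    G.Adj (T.segVert i p) (T.segVert i (p + 1)) := by
  rw [← mem_edgeSet, T.segEdge hp, mem_edgeSet]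
  exact T.adj _

theorem segEdge_inj {i j p q : ℕ} (hi : i < C.supp.ncard) (hj : j < C.supp.ncard)
    (hp : p < T.segLength i) (hq : q < T.segLength j)
    (h : s(T.segVert i p, T.segVert i (p + 1)) = s(T.segVert j q, T.segVert j (q + 1))) :
    i = j ∧ p = q := by
  rw [T.segEdge hp, T.segEdge hq] at h
  have hi1 := T.segPos_mem hp
  have hj1 := T.segPos_mem hq
  have hmono : ∀ a b, a ≤ b → T.cut a ≤ T.cut b := fun a b h => T.cut_strictMono.monotone h
  have hi2 := hmono 0 i (by omega)
  have hj2 := hmono 0 j (by omega)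
  have hi3 := hmono (i + 1) _ hi
  have hj3 := hmono (j + 1) _ hj
  have hn := T.cut_ncard
  -- all positions lie in one period
  have hmod := T.edge_inj _ _ h
  have hpos : T.segPos i p = T.segPos j q := by
    have h1 : T.cut 0 + (T.segPos i p - T.cut 0) ≡ T.cut 0 + (T.segPos j q - T.cut 0)
        [MOD T.length] := by
      rwa [Nat.add_sub_cancel' (by omega), Nat.add_sub_cancel' (by omega)]
    have h2 := (h1.add_left_cancel' _).eq_of_lt_of_lt (by omega) (by omega)
    omega
  have hij : i = j := by
    rcases lt_trichotomy i j with hij | hij | hij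
    · have := hmono (i + 1) j hij
      omega
    · exact hij
    · have := hmono (j + 1) i hij
      omega
  subst hij
  exact ⟨rfl, T.segPos_injOn hp hq hpos⟩

theorem segEdge_surj {v w : V} (hv : v ∈ C.supp) (h : G.Adj v w) :
    ∃ i < C.supp.ncard, ∃ p < T.segLength i,
      s(T.segVert i p, T.segVert i (p + 1)) = s(v, w) := by
  obtain ⟨q, hq⟩ := T.edge_surj v w hv h
  -- the representative of `q` in the period that starts at `T.cut 0`
  let q' := T.cut 0 + (q + T.cut 0 * (T.length - 1)) % T.length
  have hq' : q' ≡ q [MOD T.length] := by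
    have h1 : q' ≡ T.cut 0 + (q + T.cut 0 * (T.length - 1)) [MOD T.length] :=
      (Nat.mod_modEq _ _).add_left _
    refine h1.trans ?_
    have h2 : T.cut 0 + (q + T.cut 0 * (T.length - 1)) = q + T.length * T.cut 0 := by
      obtain ⟨m, hm⟩ := Nat.exists_eq_add_of_le' T.length_pos
      rw [hm]
      simp only [Nat.add_sub_cancel]
      ring
    rw [h2]
    exact Nat.add_mul_mod_self_left _ _ _
  have hlt := Nat.mod_lt (q + T.cut 0 * (T.length - 1)) T.length_pos
  obtain ⟨i, hi, h1, h2⟩ := exists_lt_and_mem_Ico_of_le T.cut (n := C.supp.ncard) (p := q')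
    (Nat.le_add_right _ _) (by rw [T.cut_ncard]; exact Nat.add_lt_add_left hlt _)
  obtain ⟨p, hp, hpq⟩ := T.exists_segPos_eq h1 h2
  refine ⟨i, hi, p, hp, ?_⟩
  rw [T.segEdge hp, hpq, T.vert_eq_of_modEq hq', T.vert_eq_of_modEq (hq'.add_right 1), hq]

theorem vert_cut_succ {i : ℕ} :
    T.vert (T.cut (i + 1)) = T.vert (T.cut (if i + 1 = C.supp.ncard then 0 else i + 1)) := by
  split_ifs with h
  · rw [h]
    simpa using T.vert_cut_periodic 0
  · rfl

theorem segVert_segLength (i : ℕ) : T.segVert i (T.segLength i) =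
    T.vert (T.cut (segmentTarget C.supp.ncard i)) := by
  have := T.cut_lt_cut_succ i
  unfold segVert segLength segmentTarget
  split_ifs with h1 h2
  · rw [Nat.add_sub_cancel' this.le, T.vert_cut_succ, if_pos h2]
  · rw [Nat.add_sub_cancel' this.le]
  · rw [Nat.sub_sub_self this.le]

theorem segVert_zero (i : ℕ) : T.segVert i 0 =
    T.vert (T.cut (segmentSource C.supp.ncard i)) := by
  unfold segVert segmentSource
  split_ifs with h1 h2
  · rfl
  · rw [Nat.sub_zero, T.vert_cut_succ, if_pos h2]
  · rfl

end ConnectedComponent.SplitTour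

variable {V : Type*} {G : SimpleGraph V}

open Classical in
/-- Only segments of `C` have ends in `C`, so a sum over all segments with a given end in `C` is
a sum over the segments of `C`. -/
theorem sum_sigma_ite_vert_cut [Fintype G.ConnectedComponent]
    (T : ∀ C : G.ConnectedComponent, C.SplitTour)
    (f : ℕ → ℕ → ℕ) (hf : ∀ n, ∀ i < n, f n i < n) (e : G.ConnectedComponent → ℕ → V)
    (he : ∀ C i, e C i = (T C).vert ((T C).cut (f C.supp.ncard i)))
    (g : G.ConnectedComponent → ℕ → ℤ) (C : G.ConnectedComponent) {k : ℕ}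
    (hk : k < C.supp.ncard) :
    (∑ j : Σ C : G.ConnectedComponent, Fin C.supp.ncard,
      if e j.1 j.2 = (T C).vert ((T C).cut k) then g j.1 j.2 else 0) =
    ∑ i ∈ Finset.range C.supp.ncard, if f C.supp.ncard i = k then g C i else 0 := by
  rw [Fintype.sum_sigma, Finset.sum_eq_single C]
  · rw [Finset.sum_range]
    refine Finset.sum_congr rfl fun i _ => ?_
    refine if_congr ?_ rfl rfl
    simp only [he]
    exact ⟨fun h => (T C).cut_index_inj (hf _ _ i.2) hk h, fun h => by rw [h]⟩
  · intro C' _ hC'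
    refine Finset.sum_eq_zero fun i _ => if_neg fun h => hC' ?_
    simp only [he] at h
    have h1 := (T C').vert_mem ((T C').cut (f C'.supp.ncard i))
    have h2 := (T C).vert_mem ((T C).cut k)
    rw [h] at h1
    rw [ConnectedComponent.mem_supp_iff] at h1 h2
    rw [← h1, h2]
  · intro h
    exact absurd (Finset.mem_univ _) h

/-- Arrangements of the single components combine to an antimagic labelling if the components
receive consecutive blocks of labels in the order of `rank`, and if the exceptional sums `X C` of
the odd components are distinct and smaller than the sum of every sink. -/
theorem hasAntimagicOrientation_of_splitTours [Fintype V] [Fintype G.ConnectedComponent]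
    [DecidableRel G.Adj] {k : ℕ} (hreg : G.IsRegularOfDegree k)
    (T : ∀ C : G.ConnectedComponent, C.SplitTour) (a : G.ConnectedComponent → ℕ → ℕ)
    (rank X : G.ConnectedComponent → ℕ) (hrank : Function.Injective rank)
    (harr : ∀ C, IsArrangement C.supp.ncard (T C).segLength (a C))
    (hX : ∀ C : G.ConnectedComponent, C.supp.ncard % 2 = 1 →
      a C 0 + X C = a C (C.supp.ncard - 1) + (T C).segLength (C.supp.ncard - 1))
    (hXinj : ∀ C C' : G.ConnectedComponent, C.supp.ncard % 2 = 1 → C'.supp.ncard % 2 = 1 →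
      X C = X C' → C = C')
    (hXsink : ∀ C C' : G.ConnectedComponent, C.supp.ncard % 2 = 1 →
      ∀ k < C'.supp.ncard, k % 2 = 1 → X C < 2 * keyOffset Finset.univ
          (fun C => ∑ i ∈ Finset.range C.supp.ncard, (T C).segLength i) rank C' +
        (a C' (k - 1) + (T C').segLength (k - 1) + (a C' k + (T C').segLength k) + 1)) :
    G.HasAntimagicOrientation := by
  classical
  set L : G.ConnectedComponent → ℕ :=
    fun C => ∑ i ∈ Finset.range C.supp.ncard, (T C).segLength i with hL
  set base : G.ConnectedComponent → ℕ := keyOffset Finset.univ L rank with hbase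
  have hbase_ne : ∀ C C', C ≠ C' → base C + L C ≤ base C' ∨ base C' + L C' ≤ base C := by
    intro C C' h
    rcases lt_or_gt_of_ne (hrank.ne h) with h | h
    · exact Or.inl (keyOffset_add_le L rank (Finset.mem_univ _) h)
    · exact Or.inr (keyOffset_add_le L rank (Finset.mem_univ _) h)
  refine G.hasAntimagicOrientation_of_trails hreg
    (ι := Σ C : G.ConnectedComponent, Fin C.supp.ncard)
    (fun j => (T j.1).segLength j.2) (fun j => base j.1 + a j.1 j.2)
    (fun j => (T j.1).segVert j.2) (fun j p hp => (T j.1).segVert_adj hp) ?_ ?_ ?_ ?_ ?_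
  · rintro ⟨C, i, hi⟩ p hp ⟨C', j, hj⟩ q hq h
    -- an edge determines its component
    have hCC : C = C' := by
      have h1 : (T C).segVert i p ∈ C'.supp := by
        have : (T C).segVert i p ∈ s((T C).segVert i p, (T C).segVert i (p + 1)) :=
          Sym2.mem_mk_left _ _
        rw [h, Sym2.mem_iff] at this
        rcases this with h | h <;> rw [h] <;> exact (T C').segVert_mem _ _
      have h2 := (T C).segVert_mem i p
      rw [ConnectedComponent.mem_supp_iff] at h1 h2
      rw [← h1, h2]
    subst hCC
    obtain ⟨rfl, rfl⟩ := (T C).segEdge_inj hi hj hp hq h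
    exact ⟨rfl, rfl⟩
  · intro u v h
    obtain ⟨i, hi, p, hp, h⟩ :=
      (T (G.connectedComponentMk u)).segEdge_surj ConnectedComponent.connectedComponentMk_mem h
    exact ⟨⟨_, i, hi⟩, p, hp, h⟩
  · rintro ⟨C, i, hi⟩ p hp ⟨C', j, hj⟩ q hq h
    simp only at hp hq h
    have h1 := (harr C).add_le i hi
    have h2 := (harr C').add_le j hj
    have hCC : C = C' := by
      by_contra hne
      rcases hbase_ne C C' hne with hb | hb <;> simp only [hL] at hb <;> omega
    subst hCC
    have hij : i = j := by
      by_contra hne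
      rcases (harr C).disjoint i hi j hj hne with hb | hb <;> omega
    subst hij
    exact ⟨rfl, by omega⟩
  · rintro ⟨C, i, hi⟩
    have h1 := (harr C).add_le i hi
    have h2 : base C + L C ≤ ∑ C, L C := keyOffset_add_le_sum L rank (Finset.mem_univ _)
    have h3 : ∑ j : Σ C : G.ConnectedComponent, Fin C.supp.ncard, (T j.1).segLength j.2 =
        ∑ C, L C := by
      rw [Fintype.sum_sigma]
      exact Finset.sum_congr rfl fun C _ => (Finset.sum_range (T C).segLength).symm
    simp only at h3 ⊢
    rw [h3]
    simp only [hL] at h2 ⊢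
    omega
  · have htgt : ∀ n, ∀ i < n, segmentTarget n i < n := by
      intro n i hi
      unfold segmentTarget
      split_ifs <;> omega
    have hsrc : ∀ n, ∀ i < n, segmentSource n i < n := by
      intro n i hi
      unfold segmentSource
      split_ifs <;> omega
    have key : ∀ (C : G.ConnectedComponent) (k : ℕ), k < C.supp.ncard →
        (∑ j : Σ C : G.ConnectedComponent, Fin C.supp.ncard,
          if (T j.1).segVert j.2 ((T j.1).segLength j.2) = (T C).vert ((T C).cut k) then
            2 * (((base j.1 + a j.1 j.2 : ℕ) : ℤ) + ((T j.1).segLength j.2 : ℕ)) + 1 else 0) -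
        (∑ j : Σ C : G.ConnectedComponent, Fin C.supp.ncard,
          if (T j.1).segVert j.2 0 = (T C).vert ((T C).cut k) then
            2 * ((base j.1 + a j.1 j.2 : ℕ) : ℤ) + 1 else 0) =
        blockSum C.supp.ncard (T C).segLength (fun i => base C + a C i) k := by
      intro C k hk
      rw [sum_sigma_ite_vert_cut T segmentTarget htgt
        (fun C i => (T C).segVert i ((T C).segLength i)) (fun C i => (T C).segVert_segLength i)
        (fun C i => 2 * (((base C + a C i : ℕ) : ℤ) + ((T C).segLength i : ℕ)) + 1) C hk,
        sum_sigma_ite_vert_cut T segmentSource hsrc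
        (fun C i => (T C).segVert i 0) (fun C i => (T C).segVert_zero i)
        (fun C i => 2 * ((base C + a C i : ℕ) : ℤ) + 1) C hk]
      rfl
    intro v w hvw
    obtain ⟨i, hi, hv⟩ := (T (G.connectedComponentMk v)).exists_cut_lt
      ConnectedComponent.connectedComponentMk_mem
    obtain ⟨j, hj, hw⟩ := (T (G.connectedComponentMk w)).exists_cut_lt
      ConnectedComponent.connectedComponentMk_mem
    simp only at hvw
    rw [← hv, ← hw] at hvw
    generalize G.connectedComponentMk v = C at *
    generalize G.connectedComponentMk w = C' at *
    rw [key C i hi, key C' j hj] at hvw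
    obtain ⟨rfl, rfl⟩ := blockSum_injective (n := fun C => C.supp.ncard)
      (l := fun C => (T C).segLength) harr (fun C i => (T C).segLength_pos i) hbase_ne hX hXinj
      hXsink hi hj hvw
    exact hv.symm.trans hw

end SimpleGraph

/-! ### Choosing the exceptional sums -/

/-- Each of `k` strictly increasing sequences has `k` distinct values among its first `k` terms, so
by Hall's theorem one can choose a term of each so that the chosen values are distinct. -/
theorem exists_injective_choice {α : Type*} [Finite α] {k : ℕ} (hk : Nat.card α = k)
    (f : α → ℕ → ℕ) (hf : ∀ a, StrictMono (f a)) :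
    ∃ r : α → ℕ, (∀ a, r a < k) ∧ Function.Injective fun a => f a (r a) := by
  classical
  have := Fintype.ofFinite α
  have hall : ∀ s : Finset α,
      s.card ≤ (s.biUnion fun a => (Finset.range k).image (f a)).card := by
    intro s
    rcases s.eq_empty_or_nonempty with rfl | ⟨a, ha⟩
    · simp
    · have h1 : s.card ≤ k := by
        rw [← hk, Nat.card_eq_fintype_card]
        exact s.card_le_univ
      have h2 := Finset.card_image_of_injective (Finset.range k) (hf a).injective
      rw [Finset.card_range] at h2
      exact (h1.trans h2.ge).trans (Finset.card_le_card
        (Finset.subset_biUnion_of_mem (fun a => (Finset.range k).image (f a)) ha))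
  obtain ⟨g, hg, hg'⟩ := (Finset.all_card_le_biUnion_card_iff_exists_injective _).1 hall
  simp only [Finset.mem_image, Finset.mem_range] at hg'
  choose r hr hr' using hg'
  exact ⟨r, hr, by simpa only [hr'] using hg⟩

namespace SimpleGraph

theorem hasAntimagicOrientation_of_large_oddComponents {V : Type*} [Fintype V]
    {G : SimpleGraph V} [DecidableRel G.Adj] {d k : ℕ} (hd : 0 < d)
    (hreg : G.IsRegularOfDegree (2 * d)) (hk : G.oddComponents.ncard = k)
    (hlarge : ∀ C ∈ G.oddComponents, 2 * ((k + 1) * (2 * d)) + k + 3 ≤ C.supp.ncard) :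
    G.HasAntimagicOrientation := by
  classical
  have := Fintype.ofFinite G.ConnectedComponent
  have hodd : ∀ C : G.ConnectedComponent, C ∈ G.oddComponents ↔ C.supp.ncard % 2 = 1 :=
    fun C => Nat.odd_iff
  -- rotate the tours so that the segments `n - 1, 0, …, k - 1` of each component have
  -- bounded total length
  have htour : ∀ C : G.ConnectedComponent, ∃ T : C.SplitTour, ∀ r < k,
      T.segLength (C.supp.ncard - 1) + ∑ i ∈ Finset.range (r + 1), T.segLength i ≤
        (k + 1) * (2 * d) := by
    intro C
    obtain ⟨T⟩ := C.nonempty_splitTour (fun v => by rw [hreg.degree_eq]; simp)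
      (fun v => by rw [hreg.degree_eq]; omega)
    obtain ⟨c, hc⟩ := T.exists_short_window (T.length_le hreg) (k + 1)
    refine ⟨T.shift (c + 1), fun r hr => ?_⟩
    have hn := T.ncard_pos
    rw [(T.shift (c + 1)).sum_segLength]
    unfold ConnectedComponent.SplitTour.segLength ConnectedComponent.SplitTour.shift
    simp only
    rw [show C.supp.ncard - 1 + 1 + (c + 1) = c + 1 + C.supp.ncard by omega,
      show C.supp.ncard - 1 + (c + 1) = c + C.supp.ncard by omega, T.cut_add, T.cut_add, zero_add]
    have h1 : T.cut (r + 1 + (c + 1)) ≤ T.cut (c + (k + 1)) :=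
      T.cut_strictMono.monotone (by omega)
    have h2 := T.cut_lt_cut_succ c
    have h3 : T.cut (c + 1) ≤ T.cut (r + 1 + (c + 1)) := T.cut_strictMono.monotone (by omega)
    omega
  choose T hT using htour
  -- the exceptional sum of an odd component under the tent key, as a function of `r`
  let val : G.ConnectedComponent → ℕ → ℕ := fun C r =>
    (T C).segLength (C.supp.ncard - 1) + ∑ i ∈ Finset.range (r + 1), (T C).segLength i
  have hval : ∀ C, StrictMono (val C) := by
    refine fun C => strictMono_nat_of_lt_succ fun r => ?_
    have := (T C).segLength_pos (r + 1)
    simp only [val, Finset.sum_range_succ _ (r + 1)]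
    omega
  obtain ⟨r, hr, hrinj⟩ := exists_injective_choice (α := G.oddComponents) hk
    (fun C => val C) (fun C => hval C)
  -- `P` singles out one odd component, if there is any, to receive the lowest labels
  obtain ⟨P, hPodd, hPuniq, hPex⟩ : ∃ P : G.ConnectedComponent → Prop,
      (∀ C, P C → C ∈ G.oddComponents) ∧ (∀ C C', P C → P C' → C = C') ∧
        ∀ C ∈ G.oddComponents, ∃ C₀, P C₀ := by
    rcases G.oddComponents.eq_empty_or_nonempty with h | ⟨C₀, hC₀⟩
    · exact ⟨fun _ => False, fun _ h => h.elim, fun _ _ h => h.elim, fun C hC => by simp [h] at hC⟩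
    · exact ⟨fun C => C = C₀, fun _ h => h ▸ hC₀, fun _ _ h h' => h.trans h'.symm,
        fun _ _ => ⟨C₀, rfl⟩⟩
  let r' : G.ConnectedComponent → ℕ := fun C => if h : C ∈ G.oddComponents then r ⟨C, h⟩ else 0
  have hr' : ∀ C (h : C ∈ G.oddComponents), r' C = r ⟨C, h⟩ := fun C h => dif_pos h
  let a : G.ConnectedComponent → ℕ → ℕ := fun C =>
    keyOffset (Finset.range C.supp.ncard) (T C).segLength
      (if P C then tierKey C.supp.ncard else tentKey C.supp.ncard (r' C))
  -- the exceptional sum, if `C` is odd: the interval of segment `0` starts at `0`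
  let last : G.ConnectedComponent → ℕ := fun C =>
    a C (C.supp.ncard - 1) + (T C).segLength (C.supp.ncard - 1)
  have hlastP : ∀ C, P C → C.supp.ncard / 2 + 1 ≤ last C := by
    intro C hC
    simp only [last, a, if_pos hC]
    exact le_keyOffset_tierKey_last (T C).segLength_pos ((hodd C).1 (hPodd C hC))
  have hlast : ∀ C, ¬ P C → C ∈ G.oddComponents → last C = val C (r' C) := by
    intro C hC hC'
    have h1 := hlarge C hC'
    have h2 := hr ⟨C, hC'⟩
    simp only [last, a, if_neg hC, val]
    rw [keyOffset_tentKey_last _ (by rw [hr' C hC']; omega), add_comm]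
  have hsmall : ∀ C C₀, ¬ P C → C ∈ G.oddComponents → P C₀ → last C < last C₀ := by
    intro C C₀ hC hC' hC₀
    have h1 := hlastP C₀ hC₀
    have h2 := hlarge C₀ (hPodd C₀ hC₀)
    have h3 : val C (r' C) ≤ (k + 1) * (2 * d) := hT C _ (by rw [hr' C hC']; exact hr _)
    rw [hlast C hC hC']
    omega
  let rank : G.ConnectedComponent → ℕ := fun C =>
    if P C then 0 else (Fintype.equivFin G.ConnectedComponent C : ℕ) + 1
  have hrank : Function.Injective rank := by
    intro C C' h
    by_cases hC : P C <;> by_cases hC' : P C' <;>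
      simp only [rank, hC, hC', if_true, if_false] at h
    · exact hPuniq C C' hC hC'
    · omega
    · omega
    · exact (Fintype.equivFin _).injective (Fin.ext (by omega))
  refine hasAntimagicOrientation_of_splitTours hreg T a rank last hrank ?_ ?_ ?_ ?_
  · intro C
    by_cases hC : P C
    · simp only [a, if_pos hC]
      exact isArrangement_tierKey (T C).segLength_pos ((hodd C).1 (hPodd C hC))
    · simp only [a, if_neg hC]
      refine isArrangement_tentKey (T C).segLength_pos fun heven => dif_neg fun h => ?_
      have := (hodd C).1 h
      omega
  · intro C _
    have h0 : a C 0 = 0 := by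
      by_cases hC : P C
      · simp only [a, if_pos hC, keyOffset_tierKey_zero]
      · simp only [a, if_neg hC, keyOffset_tentKey_zero]
    rw [h0, zero_add]
  · intro C C' h h' heq
    rw [← hodd] at h h'
    by_cases hC : P C <;> by_cases hC' : P C'
    · exact hPuniq C C' hC hC'
    · exact absurd heq (hsmall C' C hC' h' hC).ne'
    · exact absurd heq (hsmall C C' hC h hC').ne
    · rw [hlast C hC h, hlast C' hC' h', hr' C h, hr' C' h'] at heq
      exact congrArg Subtype.val (@hrinj ⟨C, h⟩ ⟨C', h'⟩ heq)
  · intro C C' h j hj hjodd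
    rw [← hodd] at h
    obtain ⟨C₀, hC₀⟩ := hPex C h
    have h1 : last C ≤ last C₀ := by
      by_cases hC : P C
      · rw [hPuniq C C₀ hC hC₀]
      · exact (hsmall C C₀ hC h hC₀).le
    by_cases hC' : P C'
    · rw [hPuniq C₀ C' hC₀ hC'] at h1
      have h2 : last C' < a C' j + (T C').segLength j := by
        simp only [last, a, if_pos hC']
        exact keyOffset_tierKey_last_lt (T C').segLength_pos ((hodd C').1 (hPodd C' hC')) hjodd
      omega
    · have h2 := keyOffset_add_le (fun C : G.ConnectedComponent =>
        ∑ i ∈ Finset.range C.supp.ncard, (T C).segLength i) rank (Finset.mem_univ C₀)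
        (show rank C₀ < rank C' by simp only [rank, if_pos hC₀, if_neg hC']; omega)
      have h3 : last C₀ ≤ ∑ i ∈ Finset.range C₀.supp.ncard, (T C₀).segLength i :=
        keyOffset_add_le_sum _ _ (Finset.mem_range.2
          (by have := (T C₀).ncard_pos; omega))
      omega

end SimpleGraph

theorem theorem2 (d : ℕ) (hd : 2 ≤ d) (k : ℕ) :
    ∃ N : ℕ, ∀ (V : Type*) [Fintype V] (G : SimpleGraph V) [DecidableRel G.Adj],
      G.IsRegularOfDegree (2 * d) →
      G.oddComponents.ncard = k →
      (∀ C ∈ G.oddComponents, N ≤ C.supp.ncard) →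
      G.HasAntimagicOrientation :=
  ⟨2 * ((k + 1) * (2 * d)) + k + 3, fun _ _ _ _ hreg hk hlarge =>
    SimpleGraph.hasAntimagicOrientation_of_large_oddComponents (by omega) hreg hk hlarge⟩
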